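/- Let $-1<q<1$, let $H_0$ be a real Hilbert space with complexification $H$, and let $\mathcal F_q(H)$ be the $q$-Fock space, i.e. the completion of $\mathbb C\Omega\oplus\bigoplus_{n\ge1}H^{\otimes n}$ (algebraic tensor powers and algebraic sum, $\Omega$ a unit vector) for the form $$\langle f_1\otimes\cdots\otimes f_m,\;g_1\otimes\cdots\otimes g_n\rangle_q=\delta_{mn}\sum_{\pi\in S_n}q^{\iota(\pi)}\prod_{i=1}^n\langle f_i,g_{\pi(i)}\rangle,$$ where $\iota(\pi)$ is the number of inversions of $\pi$. For $f\in H_0$ let $a^+(f)$ and $a^-(f)$ be the bounded operators on $\mathcal F_q(H)$ with $a^+(f)\Omega=f$, $a^+(f)(f_1\otimes\cdots\otimes f_n)=f\otimes f_1\otimes\cdots\otimes f_n$, $a^-(f)\Omega=0$ and $a^-(f)(f_1\otimes\cdots\otimes f_n)=\sum_{i=1}^nq^{i-1}\langle f,f_i\rangle f_1\otimes\cdots\otimes\widehat{f_i}\otimes\cdots\otimes f_n$. Put $\phi(f)=a^+(f)+a^-(f)$ and $\mathbb E(b)=\langle b\Omega,\Omega\rangle$. For $f_1,\dots,f_n\in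 H_0$ and $\xi_j=\phi(f_j)$ the $q$-Wick product is $$:\!\xi_1\cdots\xi_n\!:\;=\sum_{I\sqcup J=[n]}q^{\iota(I,J)}\,a^+(f_{i_1})\cdots a^+(f_{i_k})\,a^-(f_{j_1})\cdots a^-(f_{j_l}),$$ where $I=\{i_1<\dots<i_k\}$, $J=\{j_1<\dots<j_l\}$, $\iota(I,J)=\#\{(i,j)\in I\times J:i>j\}$, and the empty Wick product is the identity. A Feynman diagram $\gamma$ on $[n]=\{1,\dots,n\}$ is a partition of $[n]$ into one and two element sets; we write $(i,j)\in\gamma$ if $i<j$ and $\{i,j\}$ is a block. Let $c(\gamma)$ be the number of pairs of elements $(k,l),(i,j)\in\gamma$ with $k<i<l<j$, let $d(\gamma)$ be the number of triples $i<k<j$ with $(i,j)\in\gamma$ and $\{k\}$ a block, and let $tc(\gamma)=c(\gamma)+d(\gamma)$. If $h_1<\dots<h_r$ are the singletons of $\gamma$, put $$:\!v(\gamma)\!:\;=\Big(\prod_{(i,j)\in\gamma}\mathbb E(\xi_i\xi_j)\Big):\!\xi_{h_1}\cdots\xi_{h_r}\!:.$$ Then for every $n\ge0$ and all $f_1,\dots,f_n\in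 H_0$, with $\xi_j=\phi(f_j)$ and the convention $q^0=1$, $$\xi_1\cdots\xi_n=\sum_{\gamma}\;:\!v(\gamma)\!:\;q^{tc(\gamma)}$$ as bounded operators on $\mathcal F_q(H)$, where the sum runs over all Feynman diagrams $\gamma$ on $[n]$. -/

import Mathlib

open scoped TensorProduct ComplexConjugate DirectSum Matrix InnerProductSpace ComplexOrder

namespace QFock

/-! ### The complexification of a real inner product space -/

/-- The complexification `E ⊕ iE` of a real inner product space `E`; the pair `(x, y)` stands for
`x + iy`. -/
def Complexification (E : Type*) : Type _ := E × E

namespace Complexification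

variable {E : Type*} [NormedAddCommGroup E] [InnerProductSpace ℝ E]

instance : AddCommGroup (Complexification E) := inferInstanceAs (AddCommGroup (E × E))

/-- `(a + ib) (x + iy) = (a x - b y) + i (a y + b x)`. -/
noncomputable instance : Module ℂ (Complexification E) where
  smul c z := (c.re • z.1 - c.im • z.2, c.re • z.2 + c.im • z.1)
  one_smul z := by
    refine Prod.ext ?_ ?_
    · change (1 : ℂ).re • z.1 - (1 : ℂ).im • z.2 = z.1; simp
    · change (1 : ℂ).re • z.2 + (1 : ℂ).im • z.1 = z.2; simp
  mul_smul c d z := by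
    refine Prod.ext ?_ ?_
    · change (c * d).re • z.1 - (c * d).im • z.2 =
        c.re • (d.re • z.1 - d.im • z.2) - c.im • (d.re • z.2 + d.im • z.1)
      simp only [Complex.mul_re, Complex.mul_im]; module
    · change (c * d).re • z.2 + (c * d).im • z.1 =
        c.re • (d.re • z.2 + d.im • z.1) + c.im • (d.re • z.1 - d.im • z.2)
      simp only [Complex.mul_re, Complex.mul_im]; module
  smul_zero c := by
    refine Prod.ext ?_ ?_
    · change c.re • (0 : E) - c.im • (0 : E) = 0; simp
    · change c.re • (0 : E) + c.im • (0 : E) = 0; simp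
  zero_smul z := by
    refine Prod.ext ?_ ?_
    · change (0 : ℂ).re • z.1 - (0 : ℂ).im • z.2 = 0; simp
    · change (0 : ℂ).re • z.2 + (0 : ℂ).im • z.1 = 0; simp
  smul_add c z w := by
    refine Prod.ext ?_ ?_
    · change c.re • (z.1 + w.1) - c.im • (z.2 + w.2) =
        (c.re • z.1 - c.im • z.2) + (c.re • w.1 - c.im • w.2)
      module
    · change c.re • (z.2 + w.2) + c.im • (z.1 + w.1) =
        (c.re • z.2 + c.im • z.1) + (c.re • w.2 + c.im • w.1)
      module
  add_smul c d z := by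
    refine Prod.ext ?_ ?_
    · change (c + d).re • z.1 - (c + d).im • z.2 =
        (c.re • z.1 - c.im • z.2) + (d.re • z.1 - d.im • z.2)
      simp only [Complex.add_re, Complex.add_im]; module
    · change (c + d).re • z.2 + (c + d).im • z.1 =
        (c.re • z.2 + c.im • z.1) + (d.re • z.2 + d.im • z.1)
      simp only [Complex.add_re, Complex.add_im]; module

/-- The sesquilinear extension of the inner product of `E`, linear in the second variable. -/
@[reducible] noncomputable def core : InnerProductSpace.Core ℂ (Complexification E) where
  inner z w := ⟨inner ℝ z.1 w.1 + inner ℝ z.2 w.2, inner ℝ z.1 w.2 - inner ℝ z.2 w.1⟩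
  conj_inner_symm z w := by
    apply Complex.ext
    · simp [real_inner_comm]
    · simp [real_inner_comm]
  re_inner_nonneg z := by
    change 0 ≤ inner ℝ z.1 z.1 + inner ℝ z.2 z.2
    exact add_nonneg real_inner_self_nonneg real_inner_self_nonneg
  add_left z w v := by
    have h1 : (z + w).1 = z.1 + w.1 := rfl
    have h2 : (z + w).2 = z.2 + w.2 := rfl
    apply Complex.ext
    · simp only [h1, h2, inner_add_left, Complex.add_re]; ring
    · simp only [h1, h2, inner_add_left, Complex.add_im]; ring
  smul_left z w c := by
    have h1 : (c • z).1 = c.re • z.1 - c.im • z.2 := rfl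
    have h2 : (c • z).2 = c.re • z.2 + c.im • z.1 := rfl
    apply Complex.ext
    · simp only [h1, h2, inner_add_left, inner_sub_left, real_inner_smul_left, Complex.mul_re,
        Complex.conj_re, Complex.conj_im]
      ring
    · simp only [h1, h2, inner_add_left, inner_sub_left, real_inner_smul_left, Complex.mul_im,
        Complex.conj_re, Complex.conj_im]
      ring
  definite z h := by
    have h0 : inner ℝ z.1 z.1 + inner ℝ z.2 z.2 = 0 := congrArg Complex.re h
    have h1 : 0 ≤ inner ℝ z.1 z.1 := real_inner_self_nonneg
    have h2 : 0 ≤ inner ℝ z.2 z.2 := real_inner_self_nonneg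
    refine Prod.ext ?_ ?_
    · exact inner_self_eq_zero.1 (le_antisymm (by linarith) h1)
    · exact inner_self_eq_zero.1 (le_antisymm (by linarith) h2)

noncomputable instance : NormedAddCommGroup (Complexification E) :=
  @InnerProductSpace.Core.toNormedAddCommGroup ℂ _ _ _ _ core

noncomputable instance : InnerProductSpace ℂ (Complexification E) :=
  InnerProductSpace.ofCore core.toCore

/-- The inclusion of `E` in its complexification. -/
def ofReal (x : E) : Complexification E := (x, 0)

end Complexification

/-! ### Inversions of permutations -/

/-- The number `ι(π)` of pairs `i < j` with `π(i) > π(j)`. -/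
def inversions {n : ℕ} (π : Equiv.Perm (Fin n)) : ℕ :=
  (Finset.univ.filter fun p : Fin n × Fin n => p.1 < p.2 ∧ π p.2 < π p.1).card

theorem inversions_eq_sum {n : ℕ} (π : Equiv.Perm (Fin n)) :
    inversions π = ∑ i, ∑ j, if i < j ∧ π j < π i then 1 else 0 := by
  rw [inversions, Finset.card_filter, Fintype.sum_prod_type]

theorem inversions_inv {n : ℕ} (π : Equiv.Perm (Fin n)) : inversions π⁻¹ = inversions π := by
  unfold inversions
  refine Finset.card_bij' (fun p _ => (π⁻¹ p.2, π⁻¹ p.1)) (fun p _ => (π p.2, π p.1)) ?_ ?_ ?_ ?_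
  all_goals simp +contextual

/-- The permutation `π` with `π 0 = i` that maps the rest like `σ`. -/
def consPerm {n : ℕ} (i : Fin (n + 1)) (σ : Equiv.Perm (Fin n)) : Equiv.Perm (Fin (n + 1)) :=
  (finSuccEquiv' 0).trans ((Equiv.optionCongr σ).trans (finSuccEquiv' i).symm)

theorem consPerm_zero {n : ℕ} (i : Fin (n + 1)) (σ : Equiv.Perm (Fin n)) :
    consPerm i σ 0 = i := by
  simp [consPerm]

theorem consPerm_succ {n : ℕ} (i : Fin (n + 1)) (σ : Equiv.Perm (Fin n)) (j : Fin n) :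
    consPerm i σ j.succ = i.succAbove (σ j) := by
  have h := finSuccEquiv'_succAbove (0 : Fin (n + 1)) j
  rw [Fin.succAbove_zero] at h
  simp [consPerm, h]

theorem consPerm_bijective (n : ℕ) :
    Function.Bijective fun p : Fin (n + 1) × Equiv.Perm (Fin n) => consPerm p.1 p.2 := by
  rw [Fintype.bijective_iff_injective_and_card]
  constructor
  · rintro ⟨i, σ⟩ ⟨i', σ'⟩ h
    have h0 : i = i' := by
      have := congrArg (fun e : Equiv.Perm (Fin (n + 1)) => e 0) h
      simpa [consPerm_zero] using this
    subst h0
    refine Prod.ext rfl (Equiv.ext fun j => ?_)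
    have := congrArg (fun e : Equiv.Perm (Fin (n + 1)) => e j.succ) h
    simpa [consPerm_succ] using this
  · simp [Fintype.card_perm, Nat.factorial_succ]

theorem card_lt_aux {n : ℕ} (i : Fin (n + 1)) :
    (∑ j : Fin n, if i.succAbove j < i then 1 else 0) = (i : ℕ) := by
  have h : ∀ j : Fin n, (i.succAbove j < i) ↔ (j : ℕ) < i := by
    intro j
    rw [Fin.succAbove_lt_iff_castSucc_lt, Fin.lt_def]; rfl
  simp only [h]
  rw [← Finset.card_filter]
  have : (Finset.univ.filter fun j : Fin n => (j : ℕ) < i).map Fin.valEmbedding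
      = Finset.range i := by
    ext k
    simp only [Finset.mem_map, Finset.mem_filter, Finset.mem_univ, true_and,
      Fin.valEmbedding_apply, Finset.mem_range]
    constructor
    · rintro ⟨a, ha, rfl⟩; exact ha
    · intro hk; exact ⟨⟨k, by omega⟩, hk, rfl⟩
  rw [← Finset.card_map Fin.valEmbedding, this, Finset.card_range]

theorem inversions_consPerm {n : ℕ} (i : Fin (n + 1)) (σ : Equiv.Perm (Fin n)) :
    inversions (consPerm i σ) = i + inversions σ := by
  rw [inversions_eq_sum, inversions_eq_sum, Fin.sum_univ_succ, Fin.sum_univ_succ]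
  simp only [consPerm_zero, consPerm_succ, lt_self_iff_false, false_and, if_false, zero_add,
    Fin.succ_pos, true_and, Fin.sum_univ_succ, Fin.not_lt_zero, Fin.succ_lt_succ_iff,
    Fin.succAbove_lt_succAbove_iff]
  congr 1
  rw [Equiv.sum_comp σ (fun j => if i.succAbove j < i then 1 else 0)]
  exact card_lt_aux i

/-! ### Positivity of the form on elementary tensors -/

theorem posSemidef_prod {ι κ : Type*} [Finite ι] (s : Finset κ) (A : κ → Matrix ι ι ℂ)
    (h : ∀ k ∈ s, (A k).PosSemidef) :
    (Matrix.of fun i j => ∏ k ∈ s, A k i j).PosSemidef := by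
  classical
  induction s using Finset.induction_on with
  | empty =>
    have e : (Matrix.of fun i j => ∏ k ∈ (∅ : Finset κ), A k i j)
        = Matrix.gram ℂ (E := ℂ) (fun _ : ι => (1 : ℂ)) := by
      ext i j; simp
    rw [e]
    exact Matrix.posSemidef_gram ℂ (E := ℂ) (fun _ : ι => (1 : ℂ))
  | insert a s ha ih =>
    have h1 := (h a (Finset.mem_insert_self _ _)).hadamard
      (ih fun k hk => h k (Finset.mem_insert_of_mem hk))
    have e : (Matrix.of fun i j => ∏ k ∈ insert a s, A k i j)
        = Matrix.hadamard (A a) (Matrix.of fun i j => ∏ k ∈ s, A k i j) := by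
      ext i j; simp [Finset.prod_insert ha]
    rw [e]
    exact h1

theorem posSemidef_signKernel {ι : Type*} [Finite ι] {q : ℝ} (h1 : -1 ≤ q) (h2 : q ≤ 1)
    (x : ι → Bool) :
    (Matrix.of fun i j => if x i = x j then (1 : ℂ) else (q : ℂ)).PosSemidef := by
  have hA := (Matrix.posSemidef_gram ℂ (E := ℂ) (fun _ : ι => (1 : ℂ))).smul
    (a := (((1 + q) / 2 : ℝ) : ℂ)) (by rw [Complex.zero_le_real]; linarith)
  have hB := (Matrix.posSemidef_gram ℂ (E := ℂ)
    (fun i : ι => if x i then (1 : ℂ) else -1)).smul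
    (a := (((1 - q) / 2 : ℝ) : ℂ)) (by rw [Complex.zero_le_real]; linarith)
  have e : (Matrix.of fun i j => if x i = x j then (1 : ℂ) else (q : ℂ))
      = (((1 + q) / 2 : ℝ) : ℂ) • Matrix.gram ℂ (E := ℂ) (fun _ : ι => (1 : ℂ))
        + (((1 - q) / 2 : ℝ) : ℂ) • Matrix.gram ℂ (E := ℂ)
          (fun i : ι => if x i then (1 : ℂ) else -1) := by
    ext i j
    cases hi : x i <;> cases hj : x j <;> simp [hi, hj] <;> ring
  rw [e]
  exact hA.add hB

theorem card_disagree {n : ℕ} (π σ : Equiv.Perm (Fin n)) :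
    (Finset.univ.filter fun p : Fin n × Fin n =>
      p.1 < p.2 ∧ ¬ (decide (π p.1 < π p.2) = decide (σ p.1 < σ p.2))).card
      = inversions (σ * π⁻¹) := by
  have hA : inversions (σ * π⁻¹) = (Finset.univ.filter fun p : Fin n × Fin n =>
      π p.1 < π p.2 ∧ σ p.2 < σ p.1).card := by
    unfold inversions
    symm
    rw [← Finset.card_map (Equiv.prodCongr π π).toEmbedding]
    congr 1
    ext ⟨i, j⟩
    simp only [Finset.mem_map_equiv, Finset.mem_filter, Finset.mem_univ, true_and]
    simp
  rw [hA]
  refine Finset.card_bij'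
    (fun p _ => if π p.1 < π p.2 then (p.1, p.2) else (p.2, p.1))
    (fun p _ => if p.1 < p.2 then (p.1, p.2) else (p.2, p.1)) ?_ ?_ ?_ ?_
  · rintro ⟨a, b⟩ hp
    obtain ⟨hab, hp⟩ := (Finset.mem_filter.1 hp).2
    have hπ : π a ≠ π b := fun h => hab.ne (π.injective h)
    have hσ : σ a ≠ σ b := fun h => hab.ne (σ.injective h)
    by_cases h : π a < π b
    · have h2 : ¬ σ a < σ b := by simpa [h] using hp
      simpa [h] using lt_of_le_of_ne (not_lt.1 h2) hσ.symm
    · have h2 : σ a < σ b := by simpa [h] using hp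
      simpa [h, h2] using lt_of_le_of_ne (not_lt.1 h) hπ.symm
  · rintro ⟨a, b⟩ hp
    obtain ⟨h1, h2⟩ := (Finset.mem_filter.1 hp).2
    have hab : a ≠ b := by rintro rfl; exact lt_irrefl _ h1
    dsimp only at h1 h2
    by_cases h : a < b
    · simp [h, h1, h2.le]
    · simp [h, h1.le, h2, lt_of_le_of_ne (not_lt.1 h) hab.symm]
  · rintro ⟨a, b⟩ hp
    have hab : a < b := (Finset.mem_filter.1 hp).2.1
    by_cases h : π a < π b <;> simp [h, hab, hab.le]
  · rintro ⟨a, b⟩ hp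
    have h1 : π a < π b := (Finset.mem_filter.1 hp).2.1
    by_cases h : a < b <;> simp [h, h1, h1.le]

theorem prod_disagree (q : ℂ) {n : ℕ} (π σ : Equiv.Perm (Fin n)) :
    (∏ p : Fin n × Fin n,
      if p.1 < p.2 ∧ ¬ (decide (π p.1 < π p.2) = decide (σ p.1 < σ p.2)) then q else 1)
      = q ^ inversions (σ * π⁻¹) := by
  rw [Finset.prod_ite, Finset.prod_const, Finset.prod_const_one, mul_one, card_disagree]

theorem form_nonneg {H : Type*} [NormedAddCommGroup H] [InnerProductSpace ℂ H] {q : ℝ}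
    (h1 : -1 ≤ q) (h2 : q ≤ 1) {n : ℕ} {κ : Type*} [Fintype κ] (c : κ → ℂ)
    (f : κ → Fin n → H) :
    0 ≤ (∑ k, ∑ l, conj (c k) * c l *
      ∑ τ : Equiv.Perm (Fin n), (q : ℂ) ^ inversions τ *
        ∏ i, inner ℂ (f k i) (f l (τ i))).re := by
  classical
  have hG : (Matrix.of fun i j : κ × Equiv.Perm (Fin n) =>
      ∏ p : Fin n × Fin n, (Matrix.of fun i j : κ × Equiv.Perm (Fin n) =>
        if p.1 < p.2 ∧ ¬ (decide (i.2 p.1 < i.2 p.2) = decide (j.2 p.1 < j.2 p.2))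
          then (q : ℂ) else 1) i j).PosSemidef := by
    refine posSemidef_prod _ _ fun p _ => ?_
    by_cases hp : p.1 < p.2
    · simpa only [hp, true_and, ite_not] using posSemidef_signKernel h1 h2
        (fun i : κ × Equiv.Perm (Fin n) => decide (i.2 p.1 < i.2 p.2))
    · simpa [hp] using posSemidef_signKernel (ι := κ × Equiv.Perm (Fin n)) h1 h2
        (fun _ => true)
  have hF : (Matrix.of fun i j : κ × Equiv.Perm (Fin n) =>
      ∏ m : Fin n, Matrix.gram ℂ (fun i : κ × Equiv.Perm (Fin n) => f i.1 (i.2 m)) i j).PosSemidef :=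
    posSemidef_prod _ _ fun m _ => Matrix.posSemidef_gram ℂ _
  have h := (hG.hadamard hF).dotProduct_mulVec_nonneg (fun i => c i.1)
  have key : ((Fintype.card (Equiv.Perm (Fin n)) : ℕ) : ℂ) *
      (∑ k, ∑ l, conj (c k) * c l *
        ∑ τ : Equiv.Perm (Fin n), (q : ℂ) ^ inversions τ *
          ∏ i, inner ℂ (f k i) (f l (τ i))) = star (fun i : κ × Equiv.Perm (Fin n) => c i.1) ⬝ᵥ
      (Matrix.mulVec (Matrix.hadamard (Matrix.of fun i j : κ × Equiv.Perm (Fin n) =>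
        ∏ p : Fin n × Fin n, (Matrix.of fun i j : κ × Equiv.Perm (Fin n) =>
          if p.1 < p.2 ∧ ¬ (decide (i.2 p.1 < i.2 p.2) = decide (j.2 p.1 < j.2 p.2))
            then (q : ℂ) else 1) i j) (Matrix.of fun i j : κ × Equiv.Perm (Fin n) =>
      ∏ m : Fin n, Matrix.gram ℂ (fun i : κ × Equiv.Perm (Fin n) => f i.1 (i.2 m)) i j))
      (fun i : κ × Equiv.Perm (Fin n) => c i.1)) := by
    have hsum : ∀ (k l : κ) (π : Equiv.Perm (Fin n)),
        ∑ σ : Equiv.Perm (Fin n), (∏ p : Fin n × Fin n,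
          if p.1 < p.2 ∧ ¬ (decide (π p.1 < π p.2) = decide (σ p.1 < σ p.2))
          then (q : ℂ) else 1) * ∏ m, inner ℂ (f k (π m)) (f l (σ m))
        = ∑ τ : Equiv.Perm (Fin n), (q : ℂ) ^ inversions τ *
          ∏ i, inner ℂ (f k i) (f l (τ i)) := by
      intro k l π
      refine Fintype.sum_equiv (Equiv.mulRight π⁻¹) _ _ fun σ => ?_
      rw [prod_disagree, ← Equiv.prod_comp π (fun i => inner ℂ (f k i) (f l _))]
      simp
    simp only [dotProduct, Matrix.mulVec, Fintype.sum_prod_type, Matrix.hadamard_apply,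
      Matrix.of_apply, Matrix.gram_apply, Pi.star_apply, RCLike.star_def]
    rw [Finset.mul_sum]
    refine Finset.sum_congr rfl fun k _ => ?_
    rw [← Finset.card_univ, ← nsmul_eq_mul, ← Finset.sum_const]
    refine Finset.sum_congr rfl fun π _ => ?_
    rw [Finset.mul_sum]
    refine Finset.sum_congr rfl fun l _ => ?_
    rw [← hsum k l π, Finset.mul_sum, Finset.mul_sum]
    refine Finset.sum_congr rfl fun σ _ => ?_
    ring
  rw [← key] at h
  have h3 := (RCLike.nonneg_iff.1 h).1
  rw [RCLike.re_to_complex, ← Complex.ofReal_natCast, Complex.re_ofReal_mul] at h3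
  exact nonneg_of_mul_nonneg_right h3 (by exact_mod_cast Fintype.card_pos)

/-! ### The algebraic Fock space -/

section Algebraic

variable {H : Type*} [NormedAddCommGroup H] [InnerProductSpace ℂ H]

/-- The algebraic Fock space `ℂΩ ⊕ H ⊕ H^{⊗2} ⊕ ⋯`. -/
abbrev AlgFock (H : Type*) [NormedAddCommGroup H] [InnerProductSpace ℂ H] : Type _ :=
  ⨁ n : ℕ, ⨂[ℂ]^n H

/-- The multilinear map `(g₁, …, gₙ) ↦ ∑_π q^{ι(π)} ∏ᵢ ⟨fᵢ, g_{π(i)}⟩`. -/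
noncomputable def formRight (q : ℝ) {n : ℕ} (f : Fin n → H) :
    MultilinearMap ℂ (fun _ : Fin n => H) ℂ :=
  ∑ π : Equiv.Perm (Fin n), ((q : ℂ) ^ inversions π) •
    (MultilinearMap.mkPiAlgebra ℂ (Fin n) ℂ).compLinearMap
      (fun j => innerₛₗ ℂ (f (π⁻¹ j)))

theorem formRight_apply (q : ℝ) {n : ℕ} (f g : Fin n → H) :
    formRight q f g = ∑ π : Equiv.Perm (Fin n),
      (q : ℂ) ^ inversions π * ∏ i, inner ℂ (f i) (g (π i)) := by
  simp only [formRight, sum_apply, smul_apply,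
    MultilinearMap.compLinearMap_apply, MultilinearMap.mkPiAlgebra_apply, smul_eq_mul,
    innerₛₗ_apply_apply]
  refine Finset.sum_congr rfl fun π _ => ?_
  rw [← Equiv.prod_comp π]
  simp

theorem formRight_conj (q : ℝ) {n : ℕ} (f g : Fin n → H) :
    conj (formRight q f g) = formRight q g f := by
  rw [formRight_apply, formRight_apply, map_sum, ← Equiv.sum_comp (Equiv.inv _)]
  refine Finset.sum_congr rfl fun π _ => ?_
  rw [Equiv.inv_apply, inversions_inv, map_mul, map_pow, Complex.conj_ofReal, map_prod,
    ← Equiv.prod_comp π]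
  simp

/-- The complex conjugate of a linear functional, as a conjugate-linear functional. -/
noncomputable def conjFunctional {V : Type*} [AddCommGroup V] [Module ℂ V] (u : V →ₗ[ℂ] ℂ) :
    V →ₗ⋆[ℂ] ℂ where
  toFun x := conj (u x)
  map_add' x y := by simp
  map_smul' c x := by simp

/-- The form on `H^{⊗n}`: `formLevel q n η ξ = ⟨ξ, η⟩`, linear in `η`, conjugate-linear in `ξ`. -/
noncomputable def formLevel (q : ℝ) (n : ℕ) : ⨂[ℂ]^n H →ₗ[ℂ] ⨂[ℂ]^n H →ₗ⋆[ℂ] ℂ :=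
  PiTensorProduct.lift
    (MultilinearMap.mk' (fun g => conjFunctional (PiTensorProduct.lift (formRight q g)))
      (fun g j x y => by
        have h : (PiTensorProduct.lift (formRight q (Function.update g j (x + y)))) =
            PiTensorProduct.lift (formRight q (Function.update g j x)) +
              PiTensorProduct.lift (formRight q (Function.update g j y)) := by
          refine PiTensorProduct.ext (MultilinearMap.ext fun f => ?_)
          simp only [LinearMap.compMultilinearMap_apply, LinearMap.add_apply,
            PiTensorProduct.lift.tprod]
          rw [← formRight_conj q f, ← formRight_conj q f, ← formRight_conj q f,
            MultilinearMap.map_update_add, map_add]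
        rw [h]; ext ξ; simp [conjFunctional])
      (fun g j c x => by
        have h : (PiTensorProduct.lift (formRight q (Function.update g j (c • x)))) =
            conj c • PiTensorProduct.lift (formRight q (Function.update g j x)) := by
          refine PiTensorProduct.ext (MultilinearMap.ext fun f => ?_)
          simp only [LinearMap.compMultilinearMap_apply, LinearMap.smul_apply,
            PiTensorProduct.lift.tprod]
          rw [← formRight_conj q f, ← formRight_conj q f,
            MultilinearMap.map_update_smul, smul_eq_mul, smul_eq_mul, map_mul]
        rw [h]; ext ξ; simp [conjFunctional]))

theorem formLevel_tprod (q : ℝ) {n : ℕ} (f g : Fin n → H) :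
    formLevel q n (PiTensorProduct.tprod ℂ g) (PiTensorProduct.tprod ℂ f) =
      ∑ π : Equiv.Perm (Fin n), (q : ℂ) ^ inversions π * ∏ i, inner ℂ (f i) (g (π i)) := by
  rw [← formRight_apply, ← formRight_conj]
  simp [formLevel, conjFunctional]

/-- The hermitian form `form q η ξ = ⟨ξ, η⟩_q` on the algebraic Fock space; different levels are
orthogonal. -/
noncomputable def form (q : ℝ) : AlgFock H →ₗ[ℂ] AlgFock H →ₗ⋆[ℂ] ℂ :=
  DirectSum.toModule ℂ ℕ _ fun n =>
    (LinearMap.lcompₛₗ ℂ ℂ (starRingEnd ℂ) (DirectSum.component ℂ ℕ (fun n => ⨂[ℂ]^n H) n)).comp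
      (formLevel q n)

theorem form_lof (q : ℝ) {n : ℕ} (η : ⨂[ℂ]^n H) (ξ : AlgFock H) :
    form q (DirectSum.lof ℂ ℕ (fun n => ⨂[ℂ]^n H) n η) ξ = formLevel q n η (ξ n) := by
  simp [form, DirectSum.toModule_lof]
  rfl

/-- `f₁ ⊗ ⋯ ⊗ fₙ ↦ h ⊗ f₁ ⊗ ⋯ ⊗ fₙ`. -/
noncomputable def createLevel (h : H) (n : ℕ) : ⨂[ℂ]^n H →ₗ[ℂ] ⨂[ℂ]^(n + 1) H :=
  PiTensorProduct.lift ((PiTensorProduct.tprod ℂ (s := fun _ : Fin (n + 1) => H)).curryLeft h)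

theorem createLevel_tprod (h : H) {n : ℕ} (f : Fin n → H) :
    createLevel h n (PiTensorProduct.tprod ℂ f) =
      PiTensorProduct.tprod ℂ (Fin.cons h f : Fin (n + 1) → H) := by
  simp [createLevel]

/-- `f₁ ⊗ ⋯ ⊗ fₙ₊₁ ↦ ∑ᵢ q^{i-1} ⟨h, fᵢ⟩ f₁ ⊗ ⋯ ⊗ f̂ᵢ ⊗ ⋯ ⊗ fₙ₊₁` (in the code `i` counts from `0`,
so that the power is `q ^ i`). -/
noncomputable def annihilateLevel (q : ℝ) (h : H) (n : ℕ) :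
    ⨂[ℂ]^(n + 1) H →ₗ[ℂ] ⨂[ℂ]^n H :=
  PiTensorProduct.lift (∑ i : Fin (n + 1), ((q : ℂ) ^ (i : ℕ)) •
    LinearMap.uncurryMid (M := fun _ : Fin (n + 1) => H) i
      ((innerₛₗ ℂ h).smulRight (PiTensorProduct.tprod ℂ (s := fun _ : Fin n => H))))

theorem annihilateLevel_tprod (q : ℝ) (h : H) {n : ℕ} (f : Fin (n + 1) → H) :
    annihilateLevel q h n (PiTensorProduct.tprod ℂ f) =
      ∑ i : Fin (n + 1), ((q : ℂ) ^ (i : ℕ) * inner ℂ h (f i)) •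
        PiTensorProduct.tprod ℂ (i.removeNth f) := by
  simp [annihilateLevel, smul_smul]

/-- The creation operator on the algebraic Fock space. -/
noncomputable def create (h : H) : AlgFock H →ₗ[ℂ] AlgFock H :=
  DirectSum.toModule ℂ ℕ _ fun n =>
    (DirectSum.lof ℂ ℕ (fun n => ⨂[ℂ]^n H) (n + 1)).comp (createLevel h n)

/-- The annihilation operator on the algebraic Fock space; it kills `Ω`. -/
noncomputable def annihilate (q : ℝ) (h : H) : AlgFock H →ₗ[ℂ] AlgFock H :=
  DirectSum.toModule ℂ ℕ _ fun n =>
    match n with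
    | 0 => 0
    | n + 1 => (DirectSum.lof ℂ ℕ (fun n => ⨂[ℂ]^n H) n).comp (annihilateLevel q h n)

/-- The elementary tensor `f₁ ⊗ ⋯ ⊗ fₙ`. -/
noncomputable def elementary {n : ℕ} (f : Fin n → H) : AlgFock H :=
  DirectSum.lof ℂ ℕ (fun n => ⨂[ℂ]^n H) n (PiTensorProduct.tprod ℂ f)

theorem create_elementary (h : H) {n : ℕ} (f : Fin n → H) :
    create h (elementary f) = elementary (Fin.cons h f : Fin (n + 1) → H) := by
  rw [elementary, create, DirectSum.toModule_lof, LinearMap.comp_apply, createLevel_tprod, elementary]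

theorem annihilate_elementary_zero (q : ℝ) (h : H) (f : Fin 0 → H) :
    annihilate q h (elementary f) = 0 := by
  rw [elementary, annihilate, DirectSum.toModule_lof, LinearMap.zero_apply]

theorem annihilate_elementary_succ (q : ℝ) (h : H) {n : ℕ} (f : Fin (n + 1) → H) :
    annihilate q h (elementary f) = ∑ i : Fin (n + 1), ((q : ℂ) ^ (i : ℕ) * inner ℂ h (f i)) •
        elementary (i.removeNth f) := by
  rw [elementary, annihilate, DirectSum.toModule_lof, LinearMap.comp_apply, annihilateLevel_tprod,
    map_sum]
  simp [elementary]

theorem form_elementary (q : ℝ) {n : ℕ} (f g : Fin n → H) :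
    form q (elementary g) (elementary f) =
      ∑ π : Equiv.Perm (Fin n), (q : ℂ) ^ inversions π * ∏ i, inner ℂ (f i) (g (π i)) := by
  rw [elementary, form_lof, elementary, DirectSum.lof_apply, formLevel_tprod]

theorem form_elementary_ne (q : ℝ) {m n : ℕ} (hmn : m ≠ n) (f : Fin m → H) (g : Fin n → H) :
    form q (elementary g) (elementary f) = 0 := by
  rw [elementary, form_lof, elementary, DirectSum.lof_eq_of, DirectSum.of_eq_of_ne _ _ _ hmn.symm, map_zero]

theorem span_elementary : Submodule.span ℂ
    {x : AlgFock H | ∃ (n : ℕ) (f : Fin n → H), elementary f = x} = ⊤ := by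
  rw [eq_top_iff]
  rintro x -
  induction x using DirectSum.induction_on with
  | zero => exact Submodule.zero_mem _
  | add x y hx hy => exact Submodule.add_mem _ hx hy
  | of n t =>
    have ht : t ∈ Submodule.span ℂ (Set.range (PiTensorProduct.tprod ℂ (s := fun _ : Fin n => H))) := by
      rw [PiTensorProduct.span_tprod_eq_top]; trivial
    have := Submodule.mem_map_of_mem (f := DirectSum.lof ℂ ℕ (fun n => ⨂[ℂ]^n H) n) ht
    rw [Submodule.map_span] at this
    refine Submodule.span_mono ?_ this
    rintro _ ⟨_, ⟨f, rfl⟩, rfl⟩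
    exact ⟨n, f, rfl⟩

theorem elementary_induction {p : AlgFock H → Prop} (x : AlgFock H) (h0 : p 0)
    (hadd : ∀ x y, p x → p y → p (x + y)) (hsmul : ∀ (c : ℂ) x, p x → p (c • x))
    (h : ∀ (n : ℕ) (f : Fin n → H), p (elementary f)) : p x := by
  have hx : x ∈ Submodule.span ℂ {x : AlgFock H | ∃ (n : ℕ) (f : Fin n → H), elementary f = x} := by
    rw [span_elementary]; trivial
  induction hx using Submodule.span_induction with
  | mem x hx => obtain ⟨n, f, rfl⟩ := hx; exact h n f
  | zero => exact h0
  | add x y _ _ hx hy => exact hadd x y hx hy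
  | smul c x _ hx => exact hsmul c x hx

theorem form_conj (q : ℝ) (ξ η : AlgFock H) : conj (form q ξ η) = form q η ξ := by
  induction ξ using elementary_induction with
  | h0 => simp
  | hadd x y hx hy => simp [hx, hy]
  | hsmul c x hx => simp [hx]
  | h n f =>
    induction η using elementary_induction with
    | h0 => simp
    | hadd x y hx hy => simp [hx, hy]
    | hsmul c x hx => simp [hx]
    | h m g =>
      by_cases hmn : m = n
      · subst hmn
        rw [form_elementary, form_elementary, ← formRight_apply, ← formRight_apply, formRight_conj]
      · rw [form_elementary_ne q hmn, form_elementary_ne q (Ne.symm hmn), map_zero]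

/-- `a⁻(h)` is adjoint to `a⁺(h)`. -/
theorem form_create (q : ℝ) (h : H) (ξ η : AlgFock H) :
    form q η (create h ξ) = form q (annihilate q h η) ξ := by
  induction ξ using elementary_induction with
  | h0 => simp
  | hadd x y hx hy => simp [hx, hy]
  | hsmul c x hx => simp [hx]
  | h n f =>
    induction η using elementary_induction with
    | h0 => simp
    | hadd x y hx hy => simp [hx, hy]
    | hsmul c x hx => simp [hx]
    | h m g =>
      rw [create_elementary]
      cases m with
      | zero => rw [annihilate_elementary_zero, form_elementary_ne q (by omega)]; simp
      | succ m =>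
        rw [annihilate_elementary_succ]
        by_cases hmn : n = m
        · subst hmn
          rw [form_elementary, ← (Equiv.ofBijective _ (consPerm_bijective n)).sum_comp,
            Fintype.sum_prod_type]
          simp only [map_sum, map_smul, LinearMap.sum_apply, LinearMap.smul_apply, form_elementary,
            Equiv.ofBijective_apply, inversions_consPerm, Fin.prod_univ_succ, Fin.cons_zero,
            Fin.cons_succ, consPerm_zero, consPerm_succ, smul_eq_mul, Finset.mul_sum,
            Fin.removeNth]
          refine Finset.sum_congr rfl fun i _ => Finset.sum_congr rfl fun σ _ => ?_
          rw [pow_add]; ring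
        · rw [form_elementary_ne q (by omega)]
          simp [form_elementary_ne q hmn]

theorem annihilate_create (q : ℝ) (h : H) (ξ : AlgFock H) :
    annihilate q h (create h ξ) = ((‖h‖ ^ 2 : ℝ) : ℂ) • ξ + (q : ℂ) • create h (annihilate q h ξ) := by
  induction ξ using elementary_induction with
  | h0 => simp
  | hadd x y hx hy => simp only [map_add, hx, hy, smul_add]; abel
  | hsmul c x hx => simp only [map_smul, hx, smul_add, smul_comm c]
  | h n f =>
    rw [create_elementary, annihilate_elementary_succ, Fin.sum_univ_succ]
    congr 1
    · simp
    · cases n with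
      | zero => simp [annihilate_elementary_zero]
      | succ n =>
        rw [annihilate_elementary_succ, map_sum, Finset.smul_sum]
        refine Finset.sum_congr rfl fun i _ => ?_
        rw [map_smul, create_elementary, smul_smul]
        congr 1
        · simp [pow_succ]; ring
        · congr 1
          funext j
          refine Fin.cases ?_ (fun j => ?_) j
          · simp [Fin.removeNth]
          · simp [Fin.removeNth]

theorem form_re_nonneg {q : ℝ} (h1 : -1 ≤ q) (h2 : q ≤ 1) (ξ : AlgFock H) :
    0 ≤ (form q ξ ξ).re := by
  classical
  have hlev : ∀ (n : ℕ) (t : ⨂[ℂ]^n H), 0 ≤ (formLevel q n t t).re := by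
    intro n t
    have ht : t ∈ Submodule.span ℂ (Set.range (PiTensorProduct.tprod ℂ (s := fun _ : Fin n => H))) := by
      rw [PiTensorProduct.span_tprod_eq_top]; trivial
    obtain ⟨c, rfl⟩ := (Finsupp.mem_span_range_iff_exists_finsupp).1 ht
    have := form_nonneg h1 h2 (fun k : c.support => c k) (fun k : c.support => (k : Fin n → H))
    convert this using 2
    simp only [Finsupp.sum, map_sum, map_smulₛₗ, LinearMap.sum_apply, LinearMap.smul_apply,
      formLevel_tprod, smul_eq_mul, RingHom.id_apply]
    rw [← Finset.sum_coe_sort]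
    refine Finset.sum_congr rfl fun k _ => ?_
    rw [← Finset.sum_coe_sort, Finset.mul_sum]
    refine Finset.sum_congr rfl fun l _ => ?_
    ring
  have hs : form q ξ ξ = ∑ n ∈ ξ.support, formLevel q n (ξ n) (ξ n) := by
    have e := DirectSum.sum_support_of ξ
    calc form q ξ ξ = form q (∑ n ∈ ξ.support, DirectSum.lof ℂ ℕ (fun n => ⨂[ℂ]^n H) n (ξ n)) ξ := by
          simp only [DirectSum.lof_eq_of]; rw [e]
      _ = _ := by
          rw [map_sum, LinearMap.sum_apply]
          exact Finset.sum_congr rfl fun n _ => form_lof q (ξ n) ξ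
  rw [hs, Complex.re_sum]
  exact Finset.sum_nonneg fun n _ => hlev n _


theorem form_cauchy_schwarz {q : ℝ} (h1 : -1 ≤ q) (h2 : q ≤ 1) (ξ η : AlgFock H) :
    (form q η ξ).re ^ 2 ≤ (form q ξ ξ).re * (form q η η).re := by
  have hsymm : (form q ξ η).re = (form q η ξ).re := by
    rw [← form_conj, Complex.conj_re]
  have h : ∀ t : ℝ, 0 ≤ (form q η η).re * (t * t) + (2 * (form q η ξ).re) * t
      + (form q ξ ξ).re := by
    intro t
    have := form_re_nonneg h1 h2 (ξ + (t : ℂ) • η)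
    simp only [map_add, map_smul, LinearMap.add_apply, LinearMap.smul_apply, map_smulₛₗ,
      Complex.conj_ofReal, smul_eq_mul, Complex.add_re, Complex.re_ofReal_mul, hsymm] at this
    linarith
  have := discrim_le_zero h
  rw [discrim] at this
  linarith

theorem form_create_self (q : ℝ) (h : H) (ξ : AlgFock H) :
    (form q (create h ξ) (create h ξ)).re =
      ‖h‖ ^ 2 * (form q ξ ξ).re
        + q * (form q (annihilate q h ξ) (annihilate q h ξ)).re := by
  have h2 : form q (create h (annihilate q h ξ)) ξ
      = form q (annihilate q h ξ) (annihilate q h ξ) := by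
    rw [← form_conj, form_create, form_conj]
  rw [form_create, annihilate_create, map_add, map_smul, map_smul, LinearMap.add_apply,
    LinearMap.smul_apply, LinearMap.smul_apply, h2, smul_eq_mul, smul_eq_mul, Complex.add_re,
    Complex.re_ofReal_mul, Complex.re_ofReal_mul]

theorem form_annihilate_le {q : ℝ} (h1 : -1 ≤ q) (h2 : q ≤ 1) (h : H) (ξ : AlgFock H) {B : ℝ}
    (hB : (form q (create h (annihilate q h ξ)) (create h (annihilate q h ξ))).re ≤
      B * (form q (annihilate q h ξ) (annihilate q h ξ)).re) (hB0 : 0 ≤ B) :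
    (form q (annihilate q h ξ) (annihilate q h ξ)).re ≤ B * (form q ξ ξ).re := by
  set y := annihilate q h ξ with hy
  have e : (form q y y).re = (form q ξ (create h y)).re := by rw [form_create]
  have hy0 := form_re_nonneg h1 h2 y
  have hx0 := form_re_nonneg h1 h2 ξ
  have hc := form_cauchy_schwarz h1 h2 (create h y) ξ
  rw [← e] at hc
  rcases hy0.eq_or_lt with h0 | h0
  · rw [← h0]; positivity
  · have : (form q y y).re * (form q y y).re ≤ (form q y y).re * (B * (form q ξ ξ).re) := by
      nlinarith [mul_le_mul_of_nonneg_right hB hx0]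
    exact le_of_mul_le_mul_left this h0

theorem form_create_lof_le {q : ℝ} (hq : |q| < 1) (h : H) (n : ℕ) (t : ⨂[ℂ]^n H) :
    (form q (create h (DirectSum.lof ℂ ℕ (fun n => ⨂[ℂ]^n H) n t))
      (create h (DirectSum.lof ℂ ℕ (fun n => ⨂[ℂ]^n H) n t))).re ≤
      ‖h‖ ^ 2 / (1 - |q|) * (form q (DirectSum.lof ℂ ℕ (fun n => ⨂[ℂ]^n H) n t)
        (DirectSum.lof ℂ ℕ (fun n => ⨂[ℂ]^n H) n t)).re := by
  have h1 : -1 ≤ q := (abs_lt.1 hq).1.le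
  have h2 : q ≤ 1 := (abs_lt.1 hq).2.le
  have hpos : 0 < 1 - |q| := by linarith
  have hB0 : 0 ≤ ‖h‖ ^ 2 / (1 - |q|) := by positivity
  have hBe : ‖h‖ ^ 2 + |q| * (‖h‖ ^ 2 / (1 - |q|)) = ‖h‖ ^ 2 / (1 - |q|) := by
    field_simp; ring
  induction n with
  | zero =>
    have h0 : annihilate q h (DirectSum.lof ℂ ℕ (fun n => ⨂[ℂ]^n H) 0 t) = 0 := by
      rw [annihilate, DirectSum.toModule_lof, LinearMap.zero_apply]
    rw [form_create_self, h0]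
    have hx0 := form_re_nonneg h1 h2 (DirectSum.lof ℂ ℕ (fun n => ⨂[ℂ]^n H) 0 t)
    have : 0 ≤ |q| * (‖h‖ ^ 2 / (1 - |q|)) := by positivity
    simp only [map_zero, Complex.zero_re, mul_zero, add_zero]
    exact mul_le_mul_of_nonneg_right (by linarith) hx0
  | succ n ih =>
    have hs : annihilate q h (DirectSum.lof ℂ ℕ (fun n => ⨂[ℂ]^n H) (n + 1) t) =
        DirectSum.lof ℂ ℕ (fun n => ⨂[ℂ]^n H) n (annihilateLevel q h n t) := by
      rw [annihilate, DirectSum.toModule_lof, LinearMap.comp_apply]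
    have ha := form_annihilate_le h1 h2 h (DirectSum.lof ℂ ℕ (fun n => ⨂[ℂ]^n H) (n + 1) t)
      (by rw [hs]; exact ih _) hB0
    have hx0 := form_re_nonneg h1 h2 (DirectSum.lof ℂ ℕ (fun n => ⨂[ℂ]^n H) (n + 1) t)
    have hy0 := form_re_nonneg h1 h2
      (annihilate q h (DirectSum.lof ℂ ℕ (fun n => ⨂[ℂ]^n H) (n + 1) t))
    rw [form_create_self]
    have hq1 := mul_le_mul_of_nonneg_right (le_abs_self q) hy0
    have hq2 := mul_le_mul_of_nonneg_left ha (abs_nonneg q)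
    calc _ ≤ ‖h‖ ^ 2 * (form q (DirectSum.lof ℂ ℕ (fun n => ⨂[ℂ]^n H) (n + 1) t)
          (DirectSum.lof ℂ ℕ (fun n => ⨂[ℂ]^n H) (n + 1) t)).re +
          |q| * (‖h‖ ^ 2 / (1 - |q|) * (form q (DirectSum.lof ℂ ℕ (fun n => ⨂[ℂ]^n H) (n + 1) t)
          (DirectSum.lof ℂ ℕ (fun n => ⨂[ℂ]^n H) (n + 1) t)).re) := by linarith
      _ = _ := by rw [← mul_assoc, ← add_mul, hBe]

theorem form_sum_orthogonal (q : ℝ) (s : Finset ℕ) (z : ℕ → AlgFock H)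
    (hz : ∀ m n, m ≠ n → form q (z m) (z n) = 0) :
    form q (∑ n ∈ s, z n) (∑ n ∈ s, z n) = ∑ n ∈ s, form q (z n) (z n) := by
  simp only [map_sum, LinearMap.sum_apply]
  refine Finset.sum_congr rfl fun n hn => ?_
  exact Finset.sum_eq_single_of_mem n hn fun m _ hmn => hz m n hmn

theorem form_create_le {q : ℝ} (hq : |q| < 1) (h : H) (ξ : AlgFock H) :
    (form q (create h ξ) (create h ξ)).re ≤ ‖h‖ ^ 2 / (1 - |q|) * (form q ξ ξ).re := by
  classical
  have e : ∑ n ∈ ξ.support, DirectSum.lof ℂ ℕ (fun n => ⨂[ℂ]^n H) n (ξ n) = ξ :=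
    DirectSum.sum_support_of ξ
  have e' : create h ξ =
      ∑ n ∈ ξ.support, create h (DirectSum.lof ℂ ℕ (fun n => ⨂[ℂ]^n H) n (ξ n)) := by
    rw [← map_sum, e]
  have h1 := form_sum_orthogonal q ξ.support
    (fun n => DirectSum.lof ℂ ℕ (fun n => ⨂[ℂ]^n H) n (ξ n)) (fun m n hmn => by
      rw [form_lof, DirectSum.lof_eq_of, DirectSum.of_eq_of_ne _ _ _ hmn, map_zero])
  have h2 := form_sum_orthogonal q ξ.support
    (fun n => create h (DirectSum.lof ℂ ℕ (fun n => ⨂[ℂ]^n H) n (ξ n))) (fun m n hmn => by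
      simp only [create, DirectSum.toModule_lof, LinearMap.comp_apply]
      rw [form_lof, DirectSum.lof_eq_of, DirectSum.of_eq_of_ne _ _ _ (by omega), map_zero])
  rw [e] at h1
  rw [e', h2, h1, Complex.re_sum, Complex.re_sum, Finset.mul_sum]
  exact Finset.sum_le_sum fun n _ => form_create_lof_le hq h n (ξ n)

end Algebraic

/-! ### The `q`-Fock space and its operators -/

section Fock

/-- The algebraic Fock space of `H`, regarded as a (semi-)inner product space with the hermitian
form `⟨·,·⟩_q` for `-1 < q < 1`. -/
def PreFock (_q : Set.Ioo (-1 : ℝ) 1) (H : Type*) [NormedAddCommGroup H]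
    [InnerProductSpace ℂ H] : Type _ :=
  AlgFock H

variable (q : Set.Ioo (-1 : ℝ) 1) {H : Type*} [NormedAddCommGroup H] [InnerProductSpace ℂ H]

noncomputable instance : AddCommGroup (PreFock q H) := inferInstanceAs (AddCommGroup (AlgFock H))

noncomputable instance : Module ℂ (PreFock q H) := inferInstanceAs (Module ℂ (AlgFock H))

/-- The `q`-inner product on the algebraic Fock space. -/
@[reducible] noncomputable def preFockCore : PreInnerProductSpace.Core ℂ (PreFock q H) where
  inner ξ η := form (q : ℝ) (H := H) η ξ
  conj_inner_symm ξ η := form_conj (q : ℝ) (H := H) ξ η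
  re_inner_nonneg ξ := form_re_nonneg q.2.1.le q.2.2.le (H := H) ξ
  add_left ξ η ζ := map_add (form (q : ℝ) (H := H) ζ) ξ η
  smul_left ξ η c := (form (q : ℝ) (H := H) η).map_smulₛₗ c ξ

noncomputable instance : SeminormedAddCommGroup (PreFock q H) :=
  @InnerProductSpace.Core.toSeminormedAddCommGroup ℂ _ _ _ _ (preFockCore q)

noncomputable instance : InnerProductSpace ℂ (PreFock q H) :=
  InnerProductSpace.ofCore (preFockCore q)

theorem preFock_norm_sq (ξ : PreFock q H) : ‖ξ‖ ^ 2 = (form (q : ℝ) (H := H) ξ ξ).re := by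
  rw [@norm_sq_eq_re_inner ℂ]; rfl

/-- The `q`-Fock space `𝓕_q(H)`: the (Hausdorff) completion of the algebraic Fock space with
respect to `⟨·,·⟩_q`. -/
abbrev FockSpace (q : Set.Ioo (-1 : ℝ) 1) (H : Type*) [NormedAddCommGroup H]
    [InnerProductSpace ℂ H] : Type _ :=
  UniformSpace.Completion (PreFock q H)

/-- `create h` on the pre-Hilbert space. -/
noncomputable def preCreate (h : H) : PreFock q H →ₗ[ℂ] PreFock q H :=
  (create h : AlgFock H →ₗ[ℂ] AlgFock H)

/-- `annihilate q h` on the pre-Hilbert space. -/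
noncomputable def preAnnihilate (h : H) : PreFock q H →ₗ[ℂ] PreFock q H :=
  (annihilate (q : ℝ) h : AlgFock H →ₗ[ℂ] AlgFock H)

theorem norm_preCreate_le (h : H) (ξ : PreFock q H) :
    ‖preCreate q h ξ‖ ≤ √(‖h‖ ^ 2 / (1 - |(q : ℝ)|)) * ‖ξ‖ := by
  have hq : |(q : ℝ)| < 1 := abs_lt.2 q.2
  have hB : 0 ≤ ‖h‖ ^ 2 / (1 - |(q : ℝ)|) := div_nonneg (sq_nonneg _) (by linarith)
  refine le_of_sq_le_sq ?_ (by positivity)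
  rw [mul_pow, Real.sq_sqrt hB, preFock_norm_sq, preFock_norm_sq]
  exact form_create_le hq h (H := H) ξ

theorem norm_preAnnihilate_le (h : H) (ξ : PreFock q H) :
    ‖preAnnihilate q h ξ‖ ≤ √(‖h‖ ^ 2 / (1 - |(q : ℝ)|)) * ‖ξ‖ := by
  have hq : |(q : ℝ)| < 1 := abs_lt.2 q.2
  have hB : 0 ≤ ‖h‖ ^ 2 / (1 - |(q : ℝ)|) := div_nonneg (sq_nonneg _) (by linarith)
  refine le_of_sq_le_sq ?_ (by positivity)
  rw [mul_pow, Real.sq_sqrt hB, preFock_norm_sq, preFock_norm_sq]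
  exact form_annihilate_le q.2.1.le q.2.2.le h (H := H) ξ (form_create_le hq h _) hB

/-- The creation operator `a⁺(h)` as a bounded operator on `𝓕_q(H)`. -/
noncomputable def creation (h : H) : FockSpace q H →L[ℂ] FockSpace q H :=
  ((preCreate q h).mkContinuous _ (norm_preCreate_le q h)).completion

/-- The annihilation operator `a⁻(h)` as a bounded operator on `𝓕_q(H)`. -/
noncomputable def annihilation (h : H) : FockSpace q H →L[ℂ] FockSpace q H :=
  ((preAnnihilate q h).mkContinuous _ (norm_preAnnihilate_le q h)).completion

/-- The elementary tensor `f₁ ⊗ ⋯ ⊗ fₙ` as a vector of the pre-Hilbert space. -/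
noncomputable def preTensor {n : ℕ} (f : Fin n → H) : PreFock q H :=
  (elementary f : AlgFock H)

/-- The elementary tensor `f₁ ⊗ ⋯ ⊗ fₙ` as a vector of the `q`-Fock space. -/
noncomputable def tensor {n : ℕ} (f : Fin n → H) : FockSpace q H :=
  (preTensor q f : FockSpace q H)

theorem inner_tensor {n : ℕ} (f g : Fin n → H) :
    inner ℂ (tensor q f) (tensor q g) = ∑ π : Equiv.Perm (Fin n),
      ((q : ℝ) : ℂ) ^ inversions π * ∏ i, inner ℂ (f i) (g (π i)) := by
  rw [tensor, tensor, UniformSpace.Completion.inner_coe]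
  exact form_elementary _ _ _

theorem inner_tensor_ne {m n : ℕ} (hmn : m ≠ n) (f : Fin m → H) (g : Fin n → H) :
    inner ℂ (tensor q f) (tensor q g) = 0 := by
  rw [tensor, tensor, UniformSpace.Completion.inner_coe]
  exact form_elementary_ne _ hmn _ _

theorem creation_tensor (h : H) {n : ℕ} (f : Fin n → H) :
    creation q h (tensor q f) = tensor q (Fin.cons h f : Fin (n + 1) → H) := by
  rw [creation, tensor, ContinuousLinearMap.completion_apply_coe, LinearMap.mkContinuous_apply]
  exact congrArg (fun x : PreFock q H => (x : FockSpace q H)) (create_elementary h f)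

theorem annihilation_tensor_zero (h : H) (f : Fin 0 → H) :
    annihilation q h (tensor q f) = 0 := by
  rw [annihilation, tensor, ContinuousLinearMap.completion_apply_coe,
    LinearMap.mkContinuous_apply]
  exact (congrArg (fun x : PreFock q H => (x : FockSpace q H))
    (annihilate_elementary_zero (q : ℝ) h f)).trans UniformSpace.Completion.coe_zero

theorem annihilation_tensor_succ (h : H) {n : ℕ} (f : Fin (n + 1) → H) :
    annihilation q h (tensor q f) = ∑ i : Fin (n + 1),
      (((q : ℝ) : ℂ) ^ (i : ℕ) * inner ℂ h (f i)) • tensor q (i.removeNth f) := by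
  have e : preAnnihilate q h (preTensor q f) = ∑ i : Fin (n + 1),
      (((q : ℝ) : ℂ) ^ (i : ℕ) * inner ℂ h (f i)) • preTensor q (i.removeNth f) :=
    annihilate_elementary_succ (q : ℝ) h f
  rw [annihilation, tensor, ContinuousLinearMap.completion_apply_coe,
    LinearMap.mkContinuous_apply, e, ← UniformSpace.Completion.coe_toComplL (𝕜 := ℂ), map_sum]
  simp only [map_smul]
  rfl

/-- The vacuum vector `Ω`. -/
noncomputable def vacuum (H : Type*) [NormedAddCommGroup H] [InnerProductSpace ℂ H] :
    FockSpace q H :=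
  tensor q (![] : Fin 0 → H)

/-- The vacuum expectation `𝔼(b) = ⟨bΩ, Ω⟩`. -/
noncomputable def expectation (b : FockSpace q H →L[ℂ] FockSpace q H) : ℂ :=
  inner ℂ (vacuum q H) (b (vacuum q H))

end Fock

/-! ### `q`-Gaussians and `q`-Wick products -/

section Gaussian

variable (q : Set.Ioo (-1 : ℝ) 1) {H₀ : Type*} [NormedAddCommGroup H₀] [InnerProductSpace ℝ H₀]

/-- The bounded operators on the `q`-Fock space of the complexification of `H₀`. -/
abbrev FockOperator (q : Set.Ioo (-1 : ℝ) 1) (H₀ : Type*) [NormedAddCommGroup H₀]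
    [InnerProductSpace ℝ H₀] : Type _ :=
  FockSpace q (Complexification H₀) →L[ℂ] FockSpace q (Complexification H₀)

/-- The `q`-Gaussian `φ(f) = a⁺(f) + a⁻(f)` of a real vector `f`. -/
noncomputable def gaussian (f : H₀) : FockOperator q H₀ :=
  creation q (Complexification.ofReal f) + annihilation q (Complexification.ofReal f)

/-- The `q`-Wick product
`:φ(f₁)⋯φ(fₙ): = W(f₁,…,fₙ) = ∑ a⁺(f_{i₁})⋯a⁺(f_{i_k}) a⁻(f_{j₁})⋯a⁻(f_{j_l}) q^{ι(I,J)}`,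
summed over all `I = {i₁ < ⋯ < i_k}` with complement `J = {j₁ < ⋯ < j_l}`, where `ι(I,J)` is the
number of pairs `(i, j) ∈ I × J` with `i > j`. -/
noncomputable def wick {n : ℕ} (f : Fin n → H₀) : FockOperator q H₀ :=
  ∑ I : Finset (Fin n),
    (((q : ℝ) : ℂ) ^ ((I ×ˢ Iᶜ).filter fun p => p.2 < p.1).card) •
      ((I.sort.map fun i => creation q (Complexification.ofReal (f i))).prod *
        (Iᶜ.sort.map fun j => annihilation q (Complexification.ofReal (f j))).prod)

end Gaussian

/-! ### Feynman diagrams -/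

/-- A Feynman diagram on `S`, i.e. a partition of `S` into one and two element sets, given by the
set of its two element blocks, each written as an ordered pair `(i, j)` with `i < j`; no vertex lies
in two different pairs. -/
def FeynmanDiagram (S : Type*) [LinearOrder S] : Type _ :=
  {γ : Finset (S × S) // (∀ p ∈ γ, p.1 < p.2) ∧
    ∀ p ∈ γ, ∀ r ∈ γ, p ≠ r → p.1 ≠ r.1 ∧ p.1 ≠ r.2 ∧ p.2 ≠ r.1 ∧ p.2 ≠ r.2}

namespace FeynmanDiagram

variable {S : Type*} [LinearOrder S] [Fintype S]

instance : Fintype (FeynmanDiagram S) :=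
  @Subtype.fintype _ _ (fun _ => instDecidableAnd) _

/-- The pairs of `γ`. -/
def pairs (γ : FeynmanDiagram S) : Finset (S × S) := γ.1

/-- The vertices that lie in no pair of `γ`. -/
def singletons (γ : FeynmanDiagram S) : Finset S :=
  Finset.univ.filter fun s => ∀ p ∈ γ.pairs, s ≠ p.1 ∧ s ≠ p.2

/-- The number of left crossings `k < i < l < j`, `(k, l) ∈ γ`, of `(i, j) = p`. -/
def leftCrossings (γ : FeynmanDiagram S) (p : S × S) : ℕ :=
  (γ.pairs.filter fun r => r.1 < p.1 ∧ p.1 < r.2 ∧ r.2 < p.2).card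

/-- The crossing number `c(γ)`. -/
def crossings (γ : FeynmanDiagram S) : ℕ := ∑ p ∈ γ.pairs, γ.leftCrossings p

/-- The number `d(γ)` of degenerate crossings: triples `i < k < j` with `(i, j) ∈ γ` and `k` a
singleton. -/
def degenerateCrossings (γ : FeynmanDiagram S) : ℕ :=
  ((γ.pairs ×ˢ γ.singletons).filter fun t => t.1.1 < t.2 ∧ t.2 < t.1.2).card

/-- The total crossing number `tc(γ) = c(γ) + d(γ)`. -/
def totalCrossings (γ : FeynmanDiagram S) : ℕ := γ.crossings + γ.degenerateCrossings

/-- `:v(γ): = (∏_{(i,j) ∈ γ} 𝔼(ξᵢ ξⱼ)) :ξ_{h₁}⋯ξ_{h_r}:` for `ξᵢ = φ(fᵢ)`, where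
`h₁ < ⋯ < h_r` are the singletons of `γ`. -/
noncomputable def wickValue (q : Set.Ioo (-1 : ℝ) 1) {H₀ : Type*} [NormedAddCommGroup H₀]
    [InnerProductSpace ℝ H₀] (f : S → H₀) (γ : FeynmanDiagram S) : FockOperator q H₀ :=
  (∏ p ∈ γ.pairs, expectation q (gaussian q (f p.1) * gaussian q (f p.2))) •
    wick q fun i : Fin γ.singletons.card => f (γ.singletons.orderEmbOfFin rfl i)

end FeynmanDiagram

end QFock

/-!
The formula is a consequence of the `q`-commutation relation
`a⁻(g) a⁺(h) = ⟨g, h⟩ + q a⁺(h) a⁻(g)` alone (`annihilation_mul_creation`), so everything else takes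
place in an arbitrary `ℂ`-algebra with elements `c i`, `d i` such that
`d i * c j = G i j + q (c j * d i)`, where the indices run through finite subsets of a linear order.

Let `a` be smaller than all elements of `s`. Expanding `:ξ_s:` over the set `I` of creators and moving
`d a` to the right through the creators gives the recursion (`add_mul_normalOrder`)
`ξ_a :ξ_s: = :ξ_{a ∪ s}: + ∑_{i ∈ s} q^{#{k ∈ s | k < i}} G a i :ξ_{s \ i}:`.
The exponent of `q` is correct since the factors before the `i`-th are either creators, which `d a`
has to pass, or annihilators, each of which formed an inversion with the `i`-th factor.

On the other side, a diagram on `a ∪ T` arises from a diagram `γ` on `T` in exactly one way: `a` is left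
unpaired, or it is joined to an unpaired point `i` of `γ` (`sum_diagramsOn_insert`). The first choice
does not change the total crossing number. The second one adds the number of unpaired points before
`i` (`totalCrossingsOn_insert_insert`), because a pair around `i` exchanges its degenerate crossing
with `i` for a crossing with `(a, i)`. Thus both sides of the formula satisfy the same recursion, and
`orderedProd_add_eq_sum_diagramsOn` follows by adjoining smallest indices. Finally,
`𝔼(φ(f) φ(g)) = ⟨f, g⟩` identifies the weights.
-/

namespace QFock

/-! ### Normal ordering in an algebra with the `q`-commutation relations -/

section NormalOrder

variable {S R : Type*} [LinearOrder S] [Ring R]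

/-- The product of the `u i`, `i ∈ s`, in increasing order of `i`. -/
def orderedProd (u : S → R) (s : Finset S) : R := (s.sort.map u).prod

theorem orderedProd_empty (u : S → R) : orderedProd u ∅ = 1 := by
  simp [orderedProd]

theorem orderedProd_insert (u : S → R) {a : S} {s : Finset S} (ha : ∀ x ∈ s, a < x) :
    orderedProd u (insert a s) = u a * orderedProd u s := by
  rw [orderedProd, Finset.sort_insert _ (fun b hb => (ha b hb).le)
    (fun h => lt_irrefl a (ha a h)), List.map_cons, List.prod_cons, orderedProd]

/-- The number `ι(I, J)` of pairs `(i, j) ∈ I × J` with `i > j`. -/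
def inversionCount (I J : Finset S) : ℕ := ((I ×ˢ J).filter fun p => p.2 < p.1).card

theorem inversionCount_eq_sum (I J : Finset S) :
    inversionCount I J = ∑ i ∈ I, (J.filter (· < i)).card := by
  simp only [inversionCount, Finset.card_filter, Finset.sum_product]

theorem inversionCount_insert_left {a : S} {I J : Finset S} (ha : a ∉ I) :
    inversionCount (insert a I) J = (J.filter (· < a)).card + inversionCount I J := by
  rw [inversionCount_eq_sum, Finset.sum_insert ha, ← inversionCount_eq_sum]

theorem inversionCount_insert_right {a : S} {I J : Finset S} (ha : a ∉ J)
    (hI : ∀ x ∈ I, a < x) :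
    inversionCount I (insert a J) = inversionCount I J + I.card := by
  rw [inversionCount_eq_sum, inversionCount_eq_sum, Finset.card_eq_sum_ones,
    ← Finset.sum_add_distrib]
  refine Finset.sum_congr rfl fun i hi => ?_
  rw [Finset.filter_insert, if_pos (hI i hi), Finset.card_insert_of_notMem (by simp [ha])]

variable [Algebra ℂ R]

/-- The `q`-Wick product indexed by a finite set `s`, with creators `c` and annihilators `d`. -/
def normalOrder (q : ℂ) (c d : S → R) (s : Finset S) : R :=
  ∑ I ∈ s.powerset, q ^ inversionCount I (s \ I) • (orderedProd c I * orderedProd d (s \ I))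

theorem normalOrder_empty (q : ℂ) (c d : S → R) : normalOrder q c d ∅ = 1 := by
  simp [normalOrder, inversionCount, orderedProd_empty]

/-- Moving an annihilator to the right through an ordered product of creators. -/
theorem mul_orderedProd {q : ℂ} {c d : S → R} {G : S → S → ℂ}
    (hcomm : ∀ i j, d i * c j = G i j • 1 + q • (c j * d i)) (a : S) (I : Finset S) :
    d a * orderedProd c I = q ^ I.card • (orderedProd c I * d a) +
      ∑ i ∈ I, (q ^ (I.filter (· < i)).card * G a i) • orderedProd c (I.erase i) := by
  induction I using Finset.induction_on_min with
  | empty => simp [orderedProd_empty]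
  | insert b I hb ih =>
    have hbI : b ∉ I := fun h => lt_irrefl b (hb b h)
    have hb0 : (insert b I).filter (· < b) = ∅ := by
      ext x
      simp only [Finset.mem_filter, Finset.mem_insert, Finset.notMem_empty, iff_false]
      rintro ⟨rfl | h, hx⟩
      · exact lt_irrefl _ hx
      · exact lt_asymm hx (hb x h)
    rw [orderedProd_insert c hb, ← mul_assoc, hcomm, add_mul, smul_mul_assoc, one_mul,
      smul_mul_assoc, mul_assoc, ih, Finset.sum_insert hbI, hb0, Finset.erase_insert hbI,
      Finset.card_insert_of_notMem hbI, Finset.card_empty, pow_zero, one_mul]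
    have hsum : ∑ i ∈ I, (q ^ ((insert b I).filter (· < i)).card * G a i) •
          orderedProd c ((insert b I).erase i) =
        q • (c b * ∑ i ∈ I, (q ^ (I.filter (· < i)).card * G a i) •
          orderedProd c (I.erase i)) := by
      rw [Finset.mul_sum, Finset.smul_sum]
      refine Finset.sum_congr rfl fun i hi => ?_
      rw [Finset.filter_insert, if_pos (hb i hi),
        Finset.card_insert_of_notMem (by simp [hbI]),
        Finset.erase_insert_of_ne (hb i hi).ne,
        orderedProd_insert c (fun x hx => hb x (Finset.mem_of_mem_erase hx)),
        mul_smul_comm, smul_smul, pow_succ', mul_assoc]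
    rw [hsum, mul_add, smul_add, mul_smul_comm, smul_smul, ← pow_succ', ← mul_assoc]
    abel

/-- Summing over a subset and one of its elements is summing over an element and a subset of the
rest. -/
theorem sum_powerset_sum_mem {M : Type*} [AddCommMonoid M] (s : Finset S)
    (F : Finset S → S → M) :
    ∑ I ∈ s.powerset, ∑ i ∈ I, F I i =
      ∑ i ∈ s, ∑ I ∈ (s.erase i).powerset, F (insert i I) i := by
  rw [Finset.sum_sigma', Finset.sum_sigma']
  refine Finset.sum_bij' (fun x _ => ⟨x.2, x.1.erase x.2⟩) (fun x _ => ⟨insert x.1 x.2, x.1⟩)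
    ?_ ?_ ?_ ?_ ?_
  · rintro ⟨I, i⟩ h
    simp only [Finset.mem_sigma, Finset.mem_powerset] at h ⊢
    exact ⟨h.1 h.2, Finset.erase_subset_erase _ h.1⟩
  · rintro ⟨i, I⟩ h
    simp only [Finset.mem_sigma, Finset.mem_powerset] at h ⊢
    exact ⟨Finset.insert_subset h.1 (h.2.trans (Finset.erase_subset _ _)),
      Finset.mem_insert_self _ _⟩
  · rintro ⟨I, i⟩ h
    simp only [Finset.mem_sigma] at h
    simp [Finset.insert_erase h.2]
  · rintro ⟨i, I⟩ h
    simp only [Finset.mem_sigma, Finset.mem_powerset] at h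
    have : i ∉ I := fun hi => by simpa using h.2 hi
    simp [Finset.erase_insert this]
  · rintro ⟨I, i⟩ h
    simp only [Finset.mem_sigma] at h
    simp [Finset.insert_erase h.2]

/-- Adjoining a smallest index: the new factor is either the leftmost creator, at no cost, or the
leftmost annihilator, which forms an inversion with each creator. -/
theorem normalOrder_insert (q : ℂ) (c d : S → R) {a : S} {s : Finset S}
    (ha : ∀ x ∈ s, a < x) :
    normalOrder q c d (insert a s) = c a * normalOrder q c d s +
      ∑ I ∈ s.powerset, q ^ (inversionCount I (s \ I) + I.card) •
        (orderedProd c I * (d a * orderedProd d (s \ I))) := by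
  have has : a ∉ s := fun h => lt_irrefl a (ha a h)
  rw [normalOrder, Finset.sum_powerset_insert has, add_comm, normalOrder, Finset.mul_sum]
  congr 1
  · refine Finset.sum_congr rfl fun I hI => ?_
    have hI := Finset.mem_powerset.1 hI
    have e : insert a s \ insert a I = s \ I := by
      ext x
      simp only [Finset.mem_sdiff, Finset.mem_insert, not_or]
      refine ⟨fun h => ⟨h.1.resolve_left h.2.1, h.2.2⟩, fun h => ⟨Or.inr h.1, ?_, h.2⟩⟩
      rintro rfl
      exact has h.1
    have h0 : (s \ I).filter (· < a) = ∅ :=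
      Finset.filter_false_of_mem fun x hx => (ha x (Finset.mem_sdiff.1 hx).1).not_gt
    rw [e, inversionCount_insert_left (fun h => has (hI h)), h0, Finset.card_empty, zero_add,
      orderedProd_insert c (fun x hx => ha x (hI hx)), mul_smul_comm, mul_assoc]
  · refine Finset.sum_congr rfl fun I hI => ?_
    have hI := Finset.mem_powerset.1 hI
    rw [Finset.insert_sdiff_of_notMem _ (fun h => has (hI h)),
      inversionCount_insert_right (fun h => has (Finset.mem_sdiff.1 h).1)
        (fun x hx => ha x (hI hx)),
      orderedProd_insert d (fun x hx => ha x (Finset.mem_sdiff.1 hx).1)]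

/-- The recursion for `q`-Wick products: multiplying by a field operator on the left either
adjoins a factor or contracts it with the `i`-th factor, at the cost of one `q` for each factor
that precedes the `i`-th. -/
theorem add_mul_normalOrder {q : ℂ} {c d : S → R} {G : S → S → ℂ}
    (hcomm : ∀ i j, d i * c j = G i j • 1 + q • (c j * d i)) {a : S} {s : Finset S}
    (ha : ∀ x ∈ s, a < x) :
    (c a + d a) * normalOrder q c d s = normalOrder q c d (insert a s) +
      ∑ i ∈ s, (q ^ (s.filter (· < i)).card * G a i) • normalOrder q c d (s.erase i) := by
  have hd : d a * normalOrder q c d s =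
      (∑ I ∈ s.powerset, q ^ (inversionCount I (s \ I) + I.card) •
        (orderedProd c I * (d a * orderedProd d (s \ I)))) +
      ∑ I ∈ s.powerset, ∑ i ∈ I,
        (q ^ (inversionCount I (s \ I) + (I.filter (· < i)).card) * G a i) •
          (orderedProd c (I.erase i) * orderedProd d (s \ I)) := by
    rw [normalOrder, Finset.mul_sum, ← Finset.sum_add_distrib]
    refine Finset.sum_congr rfl fun I _ => ?_
    rw [mul_smul_comm, ← mul_assoc, mul_orderedProd hcomm, add_mul, smul_add, smul_mul_assoc,
      smul_smul, ← pow_add, mul_assoc, Finset.sum_mul, Finset.smul_sum]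
    congr 1
    refine Finset.sum_congr rfl fun i _ => ?_
    rw [smul_mul_assoc, smul_smul, pow_add, mul_assoc]
  rw [add_mul, hd, normalOrder_insert q c d ha, add_assoc]
  congr 2
  rw [sum_powerset_sum_mem]
  refine Finset.sum_congr rfl fun i hi => ?_
  rw [normalOrder, Finset.smul_sum]
  refine Finset.sum_congr rfl fun I hI => ?_
  have hI := Finset.mem_powerset.1 hI
  have hiI : i ∉ I := fun h => by simpa using hI h
  have e : s \ insert i I = s.erase i \ I := by
    ext x
    simp only [Finset.mem_sdiff, Finset.mem_insert, Finset.mem_erase, not_or]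
    tauto
  -- the factors preceding the `i`-th are split between `I` and its complement
  have hcount : ((s.erase i \ I).filter (· < i)).card + (I.filter (· < i)).card =
      (s.filter (· < i)).card := by
    rw [← Finset.card_union_of_disjoint
      (Finset.disjoint_filter_filter Finset.sdiff_disjoint), ← Finset.filter_union,
      Finset.sdiff_union_of_subset hI]
    congr 1
    ext x
    simp only [Finset.mem_filter, Finset.mem_erase]
    exact ⟨fun h => ⟨h.1.2, h.2⟩, fun h => ⟨⟨h.2.ne, h.1⟩, h.2⟩⟩
  have hfi : (insert i I).filter (· < i) = I.filter (· < i) := by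
    rw [Finset.filter_insert, if_neg (lt_irrefl i)]
  rw [Finset.erase_insert hiI, e, inversionCount_insert_left hiI, hfi, smul_smul, ← hcount]
  congr 1
  ring

end NormalOrder

/-! ### Operators on the `q`-Fock space -/

section Operators

variable (q : Set.Ioo (-1 : ℝ) 1) {H : Type*} [NormedAddCommGroup H] [InnerProductSpace ℂ H]

/-- The `q`-commutation relation on the algebraic Fock space, for two different vectors. -/
theorem annihilate_create_apply (q : ℝ) (g h : H) (ξ : AlgFock H) :
    annihilate q g (create h ξ) =
      inner ℂ g h • ξ + (q : ℂ) • create h (annihilate q g ξ) := by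
  induction ξ using elementary_induction with
  | h0 => simp
  | hadd x y hx hy => simp only [map_add, hx, hy, smul_add]; abel
  | hsmul c x hx => simp only [map_smul, hx, smul_add, smul_comm c]
  | h n f =>
    rw [create_elementary, annihilate_elementary_succ, Fin.sum_univ_succ]
    congr 1
    · simp
    · cases n with
      | zero => simp [annihilate_elementary_zero]
      | succ n =>
        rw [annihilate_elementary_succ, map_sum, Finset.smul_sum]
        refine Finset.sum_congr rfl fun i _ => ?_
        rw [map_smul, create_elementary, smul_smul]
        congr 1
        · simp [pow_succ]; ring
        · congr 1
          funext j
          refine Fin.cases ?_ (fun j => ?_) j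
          · simp [Fin.removeNth]
          · simp [Fin.removeNth]

theorem creation_coe (h : H) (ξ : PreFock q H) :
    creation q h (ξ : FockSpace q H) = (preCreate q h ξ : PreFock q H) := by
  rw [creation, ContinuousLinearMap.completion_apply_coe, LinearMap.mkContinuous_apply]

theorem annihilation_coe (h : H) (ξ : PreFock q H) :
    annihilation q h (ξ : FockSpace q H) = (preAnnihilate q h ξ : PreFock q H) := by
  rw [annihilation, ContinuousLinearMap.completion_apply_coe, LinearMap.mkContinuous_apply]

/-- The `q`-commutation relation `a⁻(g) a⁺(h) = ⟨g, h⟩ + q a⁺(h) a⁻(g)`. -/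
theorem annihilation_mul_creation (g h : H) :
    annihilation q g * creation q h =
      inner ℂ g h • 1 + ((q : ℝ) : ℂ) • (creation q h * annihilation q g) := by
  ext x
  induction x using UniformSpace.Completion.induction_on with
  | hp => exact isClosed_eq (ContinuousLinearMap.continuous _) (ContinuousLinearMap.continuous _)
  | ih ξ =>
    have e : preAnnihilate q g (preCreate q h ξ) =
        inner ℂ g h • ξ + ((q : ℝ) : ℂ) • preCreate q h (preAnnihilate q g ξ) :=
      annihilate_create_apply (q : ℝ) g h ξ
    simp only [mul_apply_eq_comp, add_apply, smul_apply, one_apply_eq_self, creation_coe,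
      annihilation_coe, e, UniformSpace.Completion.coe_add, UniformSpace.Completion.coe_smul]

variable {H₀ : Type*} [NormedAddCommGroup H₀] [InnerProductSpace ℝ H₀]

theorem expectation_gaussian_mul (f g : H₀) :
    expectation q (gaussian q f * gaussian q g) =
      inner ℂ (Complexification.ofReal f) (Complexification.ofReal g) := by
  have h0 : inner ℂ (vacuum q (Complexification H₀)) (vacuum q (Complexification H₀)) = 1 := by
    rw [vacuum, inner_tensor]
    simp [inversions]
  rw [expectation, gaussian, gaussian, mul_apply_eq_comp, add_apply, add_apply]
  have ha (h : Complexification H₀) : annihilation q h (vacuum q _) = 0 :=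
    annihilation_tensor_zero q h _
  have h1 : annihilation q (Complexification.ofReal f)
      (creation q (Complexification.ofReal g) (vacuum q _)) =
      inner ℂ (Complexification.ofReal f) (Complexification.ofReal g) • vacuum q _ := by
    simpa [ha] using DFunLike.congr_fun
      (annihilation_mul_creation q (Complexification.ofReal f) (Complexification.ofReal g))
      (vacuum q (Complexification H₀))
  have h2 : inner ℂ (vacuum q (Complexification H₀)) (creation q (Complexification.ofReal f)
      (creation q (Complexification.ofReal g) (vacuum q _))) = 0 := by
    rw [vacuum, creation_tensor, creation_tensor]
    exact inner_tensor_ne q (by norm_num) _ _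
  rw [ha, add_zero, h1, inner_add_right, h2, inner_smul_right, h0, zero_add, mul_one]

/-- A `q`-Wick product of vectors indexed by a finite set `s`, listed in increasing order, is the
normally ordered product over `s`. -/
theorem wick_orderEmbOfFin {S : Type*} [LinearOrder S] (f : S → H₀) (s : Finset S) :
    wick q (fun i : Fin s.card => f (s.orderEmbOfFin rfl i)) =
      normalOrder ((q : ℝ) : ℂ) (fun i => creation q (Complexification.ofReal (f i)))
        (fun i => annihilation q (Complexification.ofReal (f i))) s := by
  set e := s.orderEmbOfFin rfl
  have hs : Finset.univ.map e.toEmbedding = s := Finset.map_orderEmbOfFin_univ s rfl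
  have hsort (I : Finset (Fin s.card)) : I.sort.map e = (I.map e.toEmbedding).sort :=
    Finset.map_sort _ _ _ _ fun _ _ _ _ => e.le_iff_le.symm
  have hcompl (I : Finset (Fin s.card)) : Iᶜ.map e.toEmbedding = s \ I.map e.toEmbedding := by
    rw [Finset.compl_eq_univ_sdiff, Finset.map_sdiff, hs]
  rw [wick, normalOrder]
  refine Finset.sum_bij (fun I _ => I.map e.toEmbedding) ?_ ?_ ?_ ?_
  · intro I _
    exact Finset.mem_powerset.2
      ((Finset.map_subset_map.2 (Finset.subset_univ I)).trans hs.subset)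
  · intro I _ J _ h
    exact Finset.map_injective _ h
  · intro I hI
    obtain ⟨J, _, rfl⟩ :=
      Finset.subset_map_iff.1 ((Finset.mem_powerset.1 hI).trans hs.superset)
    exact ⟨J, Finset.mem_univ J, rfl⟩
  · intro I _
    have hcount : inversionCount (I.map e.toEmbedding) (Iᶜ.map e.toEmbedding) =
        ((I ×ˢ Iᶜ).filter fun p => p.2 < p.1).card := by
      simp only [inversionCount, Finset.card_filter, Finset.sum_product, Finset.sum_map,
        RelEmbedding.coe_toEmbedding, e.lt_iff_lt]
    rw [← hcompl, hcount, orderedProd, orderedProd, ← hsort, ← hsort, List.map_map,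
      List.map_map]
    rfl

end Operators

/-! ### Feynman diagrams on finite subsets -/

section Diagrams

variable {S : Type*} [LinearOrder S]

/-- The Feynman diagrams on the finite set `T`, each given by its set of pairs `(i, j)`, `i < j`. -/
def diagramsOn (T : Finset S) : Finset (Finset (S × S)) :=
  (T ×ˢ T).powerset.filter fun γ => (∀ p ∈ γ, p.1 < p.2) ∧
    ∀ p ∈ γ, ∀ r ∈ γ, p ≠ r → p.1 ≠ r.1 ∧ p.1 ≠ r.2 ∧ p.2 ≠ r.1 ∧ p.2 ≠ r.2

/-- The points of `T` that lie in no pair of `γ`. -/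
def unpaired (T : Finset S) (γ : Finset (S × S)) : Finset S :=
  T.filter fun s => ∀ p ∈ γ, s ≠ p.1 ∧ s ≠ p.2

/-- The total crossing number of the diagram `γ` on `T`, collected pair by pair: the left crossings
of `p ∈ γ`, and the unpaired points between the two points of `p`. -/
def totalCrossingsOn (T : Finset S) (γ : Finset (S × S)) : ℕ :=
  ∑ p ∈ γ, ((γ.filter fun r => r.1 < p.1 ∧ p.1 < r.2 ∧ r.2 < p.2).card +
    ((unpaired T γ).filter fun k => p.1 < k ∧ k < p.2).card)

theorem mem_diagramsOn {T : Finset S} {γ : Finset (S × S)} :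
    γ ∈ diagramsOn T ↔ (∀ p ∈ γ, p.1 ∈ T ∧ p.2 ∈ T) ∧ (∀ p ∈ γ, p.1 < p.2) ∧
      ∀ p ∈ γ, ∀ r ∈ γ, p ≠ r → p.1 ≠ r.1 ∧ p.1 ≠ r.2 ∧ p.2 ≠ r.1 ∧ p.2 ≠ r.2 := by
  simp only [diagramsOn, Finset.mem_filter, Finset.mem_powerset, Finset.subset_iff,
    Finset.mem_product]

theorem mem_unpaired {T : Finset S} {γ : Finset (S × S)} {s : S} :
    s ∈ unpaired T γ ↔ s ∈ T ∧ ∀ p ∈ γ, s ≠ p.1 ∧ s ≠ p.2 := by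
  simp [unpaired]

theorem diagramsOn_empty : diagramsOn (∅ : Finset S) = {∅} := by
  ext γ
  rw [mem_diagramsOn, Finset.mem_singleton]
  constructor
  · rintro ⟨h, -⟩
    exact Finset.eq_empty_of_forall_notMem fun p hp => by simpa using h p hp
  · rintro rfl
    simp

variable {a : S} {T : Finset S} {γ : Finset (S × S)}

theorem mem_diagramsOn_insert (hγ : γ ∈ diagramsOn T) : γ ∈ diagramsOn (insert a T) := by
  rw [mem_diagramsOn] at hγ ⊢
  exact ⟨fun p hp => ⟨Finset.mem_insert_of_mem (hγ.1 p hp).1,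
    Finset.mem_insert_of_mem (hγ.1 p hp).2⟩, hγ.2⟩

theorem notMem_of_mem_diagramsOn (ha : ∀ x ∈ T, a < x) (hγ : γ ∈ diagramsOn T) (i : S) :
    (a, i) ∉ γ := fun h => lt_irrefl a (ha a ((mem_diagramsOn.1 hγ).1 _ h).1)

theorem unpaired_insert (ha : ∀ x ∈ T, a < x) (hγ : γ ∈ diagramsOn T) :
    unpaired (insert a T) γ = insert a (unpaired T γ) := by
  rw [unpaired, Finset.filter_insert, if_pos, unpaired]
  intro p hp
  have h := (mem_diagramsOn.1 hγ).1 p hp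
  exact ⟨(ha _ h.1).ne, (ha _ h.2).ne⟩

theorem totalCrossingsOn_insert (ha : ∀ x ∈ T, a < x) (hγ : γ ∈ diagramsOn T) :
    totalCrossingsOn (insert a T) γ = totalCrossingsOn T γ := by
  refine Finset.sum_congr rfl fun p hp => ?_
  have h := (mem_diagramsOn.1 hγ).1 p hp
  rw [unpaired_insert ha hγ, Finset.filter_insert, if_neg]
  exact fun h' => lt_asymm h'.1 (ha _ h.1)

theorem insert_mem_diagramsOn (ha : ∀ x ∈ T, a < x) (hγ : γ ∈ diagramsOn T) {i : S}
    (hi : i ∈ unpaired T γ) : insert (a, i) γ ∈ diagramsOn (insert a T) := by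
  rw [mem_unpaired] at hi
  have hγ' := mem_diagramsOn.1 hγ
  have hne : ∀ p ∈ γ, a ≠ p.1 ∧ a ≠ p.2 ∧ i ≠ p.1 ∧ i ≠ p.2 := fun p hp =>
    ⟨(ha _ (hγ'.1 p hp).1).ne, (ha _ (hγ'.1 p hp).2).ne, hi.2 p hp⟩
  rw [mem_diagramsOn]
  refine ⟨fun p hp => ?_, fun p hp => ?_, fun p hp r hr hpr => ?_⟩
  · obtain rfl | hp := Finset.mem_insert.1 hp
    · exact ⟨Finset.mem_insert_self _ _, Finset.mem_insert_of_mem hi.1⟩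
    · exact ⟨Finset.mem_insert_of_mem (hγ'.1 p hp).1, Finset.mem_insert_of_mem (hγ'.1 p hp).2⟩
  · obtain rfl | hp := Finset.mem_insert.1 hp
    · exact ha _ hi.1
    · exact hγ'.2.1 p hp
  · obtain rfl | hp := Finset.mem_insert.1 hp <;> obtain rfl | hr := Finset.mem_insert.1 hr
    · exact absurd rfl hpr
    · exact hne r hr
    · obtain ⟨h1, h2, h3, h4⟩ := hne p hp
      exact ⟨h1.symm, h3.symm, h2.symm, h4.symm⟩
    · exact hγ'.2.2 p hp r hr hpr

theorem unpaired_insert_insert (ha : ∀ x ∈ T, a < x) (i : S) :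
    unpaired (insert a T) (insert (a, i) γ) = (unpaired T γ).erase i := by
  ext x
  simp only [mem_unpaired, Finset.mem_insert, Finset.mem_erase, forall_eq_or_imp]
  constructor
  · rintro ⟨hx, hai, h⟩
    exact ⟨hai.2, hx.resolve_left hai.1, h⟩
  · rintro ⟨hxi, hx, h⟩
    exact ⟨Or.inr hx, ⟨(ha x hx).ne', hxi⟩, h⟩

/-- Joining a new smallest point `a` to the unpaired point `i` creates one degenerate crossing for
each unpaired point before `i`; a pair around `i` only trades its degenerate crossing with `i` for a
crossing with `(a, i)`. -/
theorem totalCrossingsOn_insert_insert (ha : ∀ x ∈ T, a < x) (hγ : γ ∈ diagramsOn T) {i : S}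
    (hi : i ∈ unpaired T γ) :
    totalCrossingsOn (insert a T) (insert (a, i) γ) =
      totalCrossingsOn T γ + ((unpaired T γ).filter (· < i)).card := by
  have hγ' := mem_diagramsOn.1 hγ
  rw [totalCrossingsOn, Finset.sum_insert (notMem_of_mem_diagramsOn ha hγ i),
    unpaired_insert_insert ha, add_comm, totalCrossingsOn]
  congr 1
  · refine Finset.sum_congr rfl fun p hp => ?_
    have hap : a < p.1 := ha _ (hγ'.1 p hp).1
    by_cases h : p.1 < i ∧ i < p.2
    · rw [Finset.filter_insert, if_pos ⟨hap, h⟩, Finset.card_insert_of_notMem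
        (fun h' => notMem_of_mem_diagramsOn ha hγ i (Finset.mem_filter.1 h').1),
        Finset.filter_erase, add_assoc, add_comm 1, Finset.card_erase_add_one]
      exact Finset.mem_filter.2 ⟨hi, h⟩
    · rw [Finset.filter_insert, if_neg (fun h' => h h'.2), Finset.filter_erase,
        Finset.erase_eq_of_notMem]
      exact fun h' => h (Finset.mem_filter.1 h').2
  · have h0 : (insert (a, i) γ).filter (fun r => r.1 < a ∧ a < r.2 ∧ r.2 < i) = ∅ := by
      refine Finset.filter_false_of_mem fun r hr h => ?_
      obtain rfl | hr := Finset.mem_insert.1 hr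
      · exact lt_irrefl _ h.1
      · exact lt_asymm h.1 (ha _ (hγ'.1 r hr).1)
    rw [h0, Finset.card_empty, zero_add]
    congr 1
    ext x
    simp only [Finset.mem_filter, Finset.mem_erase]
    exact ⟨fun h => ⟨h.1.2, h.2.2⟩,
      fun h => ⟨⟨h.2.ne, h.1⟩, ha x (mem_unpaired.1 h.1).1, h.2⟩⟩

/-- Conversely, a diagram on `insert a T` in which `a` is joined to `i` restricts to a diagram on `T`
with `i` unpaired. -/
theorem erase_mem_diagramsOn (hγ : γ ∈ diagramsOn (insert a T)) {i : S} (hi : (a, i) ∈ γ) :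
    γ.erase (a, i) ∈ diagramsOn T ∧ i ∈ unpaired T (γ.erase (a, i)) := by
  rw [mem_diagramsOn] at hγ
  obtain ⟨h1, h2, h3⟩ := hγ
  have hsep : ∀ p ∈ γ.erase (a, i), a ≠ p.1 ∧ a ≠ p.2 ∧ i ≠ p.1 ∧ i ≠ p.2 := fun p hp =>
    h3 _ hi p (Finset.mem_of_mem_erase hp) (Finset.ne_of_mem_erase hp).symm
  refine ⟨mem_diagramsOn.2 ⟨fun p hp => ?_, fun p hp => h2 p (Finset.mem_of_mem_erase hp),
    fun p hp r hr => h3 p (Finset.mem_of_mem_erase hp) r (Finset.mem_of_mem_erase hr)⟩,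
    mem_unpaired.2 ⟨Finset.mem_of_mem_insert_of_ne (h1 _ hi).2 (h2 _ hi).ne',
      fun p hp => (hsep p hp).2.2⟩⟩
  have h := h1 p (Finset.mem_of_mem_erase hp)
  exact ⟨Finset.mem_of_mem_insert_of_ne h.1 (hsep p hp).1.symm,
    Finset.mem_of_mem_insert_of_ne h.2 (hsep p hp).2.1.symm⟩

/-- A diagram on `T` with a new smallest point `a` arises from a diagram on `T` by leaving `a`
unpaired or by joining it to an unpaired point. -/
theorem sum_diagramsOn_insert {M : Type*} [AddCommMonoid M] (ha : ∀ x ∈ T, a < x)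
    (F : Finset (S × S) → M) :
    ∑ γ ∈ diagramsOn (insert a T), F γ =
      ∑ γ ∈ diagramsOn T, (F γ + ∑ i ∈ unpaired T γ, F (insert (a, i) γ)) := by
  classical
  rw [Finset.sum_add_distrib, ← Finset.sum_filter_not_add_sum_filter
    (diagramsOn (insert a T)) (fun γ => ∃ i, (a, i) ∈ γ)]
  congr 1
  · refine Finset.sum_congr ?_ fun _ _ => rfl
    ext γ
    rw [Finset.mem_filter]
    refine ⟨fun h => ?_, fun h => ⟨mem_diagramsOn_insert h, fun ⟨i, hi⟩ =>
      notMem_of_mem_diagramsOn ha h i hi⟩⟩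
    obtain ⟨hγ, hno⟩ := h
    rw [mem_diagramsOn] at hγ ⊢
    refine ⟨fun p hp => ?_, hγ.2⟩
    have h1 : p.1 ∈ T := Finset.mem_of_mem_insert_of_ne (hγ.1 p hp).1
      fun h => hno ⟨p.2, by rw [← h]; exact hp⟩
    exact ⟨h1, Finset.mem_of_mem_insert_of_ne (hγ.1 p hp).2
      ((ha _ h1).trans (hγ.2.1 p hp)).ne'⟩
  · rw [Finset.sum_sigma']
    symm
    refine Finset.sum_bij (fun x _ => insert (a, x.2) x.1) ?_ ?_ ?_ fun _ _ => rfl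
    · rintro ⟨γ, i⟩ h
      rw [Finset.mem_sigma] at h
      exact Finset.mem_filter.2 ⟨insert_mem_diagramsOn ha h.1 h.2, i, Finset.mem_insert_self _ _⟩
    · rintro ⟨γ, i⟩ h ⟨γ', i'⟩ h' e
      rw [Finset.mem_sigma] at h h'
      have hγ := notMem_of_mem_diagramsOn ha h.1 i
      have hγ' := notMem_of_mem_diagramsOn ha h'.1
      dsimp only at e hγ hγ'
      have hmem : (a, i) ∈ insert (a, i') γ' := by
        rw [← e]; exact Finset.mem_insert_self _ _
      obtain rfl : i = i' :=
        (Prod.ext_iff.1 (Finset.mem_insert.1 hmem |>.resolve_right (hγ' i))).2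
      obtain rfl : γ = γ' := by
        rw [← Finset.erase_insert hγ, e, Finset.erase_insert (hγ' i)]
      rfl
    · intro γ h
      obtain ⟨hγ, i, hi⟩ := Finset.mem_filter.1 h
      obtain ⟨h1, h2⟩ := erase_mem_diagramsOn hγ hi
      exact ⟨⟨γ.erase (a, i), i⟩, Finset.mem_sigma.2 ⟨h1, h2⟩, Finset.insert_erase hi⟩

end Diagrams

/-! ### The Wick formula -/

section WickFormula

variable {S R : Type*} [LinearOrder S] [Ring R] [Algebra ℂ R]

/-- The Wick formula for any operators that satisfy the `q`-commutation relations, by adjoining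
smallest indices one at a time. -/
theorem orderedProd_add_eq_sum_diagramsOn {q : ℂ} {c d : S → R} {G : S → S → ℂ}
    (hcomm : ∀ i j, d i * c j = G i j • 1 + q • (c j * d i)) (T : Finset S) :
    orderedProd (fun i => c i + d i) T = ∑ γ ∈ diagramsOn T,
      (q ^ totalCrossingsOn T γ * ∏ p ∈ γ, G p.1 p.2) • normalOrder q c d (unpaired T γ) := by
  induction T using Finset.induction_on_min with
  | empty =>
    simp [orderedProd_empty, diagramsOn_empty, totalCrossingsOn, unpaired, normalOrder_empty]
  | insert a T ha ih =>
    rw [orderedProd_insert _ ha, ih, Finset.mul_sum, sum_diagramsOn_insert ha]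
    refine Finset.sum_congr rfl fun γ hγ => ?_
    rw [mul_smul_comm, add_mul_normalOrder hcomm (fun x hx => ha x (mem_unpaired.1 hx).1),
      smul_add, totalCrossingsOn_insert ha hγ, unpaired_insert ha hγ, Finset.smul_sum]
    congr 1
    refine Finset.sum_congr rfl fun i hi => ?_
    rw [totalCrossingsOn_insert_insert ha hγ hi, unpaired_insert_insert ha,
      Finset.prod_insert (notMem_of_mem_diagramsOn ha hγ i), smul_smul]
    congr 1
    ring

end WickFormula

theorem FeynmanDiagram.singletons_eq {S : Type*} [LinearOrder S] [Fintype S]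
    (γ : FeynmanDiagram S) : γ.singletons = unpaired Finset.univ γ.pairs := by
  ext s
  simp only [singletons, Finset.mem_filter, mem_unpaired]

theorem FeynmanDiagram.totalCrossings_eq {S : Type*} [LinearOrder S] [Fintype S]
    (γ : FeynmanDiagram S) : γ.totalCrossings = totalCrossingsOn Finset.univ γ.pairs := by
  rw [totalCrossings, crossings, degenerateCrossings, Finset.card_filter, Finset.sum_product,
    totalCrossingsOn, Finset.sum_add_distrib]
  simp only [← Finset.card_filter, γ.singletons_eq]
  rfl

end QFock

theorem mainTheorem6 (q : Set.Ioo (-1 : ℝ) 1) {H₀ : Type*} [NormedAddCommGroup H₀]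
    [InnerProductSpace ℝ H₀] [CompleteSpace H₀] (n : ℕ) (f : Fin n → H₀) :
    (List.ofFn fun j => QFock.gaussian q (f j)).prod =
      ∑ γ : QFock.FeynmanDiagram (Fin n),
        (((q : ℝ) : ℂ) ^ γ.totalCrossings) • γ.wickValue q f := by
  have hprod : (List.ofFn fun j => QFock.gaussian q (f j)).prod =
      QFock.orderedProd (fun j => QFock.gaussian q (f j)) Finset.univ := by
    rw [QFock.orderedProd, Fin.sort_univ, List.ofFn_eq_map]
  have hW := QFock.orderedProd_add_eq_sum_diagramsOn
    (fun i j => QFock.annihilation_mul_creation q (QFock.Complexification.ofReal (f i))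
      (QFock.Complexification.ofReal (f j))) Finset.univ
  refine hprod.trans (hW.trans ?_)
  symm
  refine Finset.sum_bij (fun γ _ => γ.pairs) ?_ ?_ ?_ ?_
  · intro γ _
    exact QFock.mem_diagramsOn.2 ⟨fun p _ => ⟨Finset.mem_univ _, Finset.mem_univ _⟩, γ.2⟩
  · intro γ _ γ' _ h
    exact Subtype.ext h
  · intro γ hγ
    exact ⟨⟨γ, (QFock.mem_diagramsOn.1 hγ).2⟩, Finset.mem_univ _, rfl⟩
  · intro γ _
    rw [QFock.FeynmanDiagram.wickValue, QFock.wick_orderEmbOfFin, smul_smul,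
      γ.totalCrossings_eq, γ.singletons_eq]
    simp only [QFock.expectation_gaussian_mul]
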